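/- Let $F=(F_1,F_2,F_3)$ be a triple of hermitian complex $3\times 3$ matrices and let $$L(F)=\{(\operatorname{tr}(\rho F_1),\operatorname{tr}(\rho F_2),\operatorname{tr}(\rho F_3)) : \rho\in\mathbb C^{3\times 3},\ \rho\succeq 0,\ \operatorname{tr}\rho=1\}\subset\mathbb R^3$$ be its joint algebraic numerical range (equivalently, the convex hull of the joint numerical range of $F$). An exposed face of $L(F)$ is a subset which is either empty or the set of all maximizers of a linear functional on $L(F)$. A large face of $L(F)$ is an exposed face $G\neq L(F)$ of $L(F)$ which is a (non-degenerate) segment or a (non-degenerate) filled ellipse. A point $p\in L(F)$ is a corner point of $L(F)$ if its normal cone $\{u\in\mathbb R^3 : \langle u,y-p\rangle\le 0\text{ for all }y\in L(F)\}$ has dimension $3$. If $G_1\neq G_2$ are two large faces of $L(F)$ both of which are segments, then $G_1\cap G_2=\{p\}$ for a corner point $p$ of $L(F)$. -/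

import Mathlib

/-- The state space of the algebra of complex `d × d` matrices: the density matrices, i.e. the
positive semi-definite matrices of trace one. -/
def stateSpace (d : ℕ) : Set (Matrix (Fin d) (Fin d) ℂ) :=
  open scoped ComplexOrder in {ρ | ρ.PosSemidef ∧ ρ.trace = 1}

/-- The expectation value map `a ↦ (⟨a, F₁⟩, …, ⟨a, Fₙ⟩)` where `⟨a, b⟩ = tr (a* b)`.
For hermitian `a` and `F i` these traces are real numbers, so taking the real part only
changes the type from `ℂ` to `ℝ`. -/
noncomputable def expectation {d n : ℕ} (F : Fin n → Matrix (Fin d) (Fin d) ℂ)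
    (a : Matrix (Fin d) (Fin d) ℂ) : EuclideanSpace ℝ (Fin n) :=
  WithLp.toLp 2 fun i => (Matrix.trace (a.conjTranspose * F i)).re

/-- The joint algebraic numerical range `L(F)`: the set of expectation values of all states. -/
def jointAlgebraicNumericalRange {d n : ℕ} (F : Fin n → Matrix (Fin d) (Fin d) ℂ) :
    Set (EuclideanSpace ℝ (Fin n)) :=
  expectation F '' stateSpace d

/-- A (non-degenerate, closed) segment. -/
def IsSegment {m : ℕ} (G : Set (EuclideanSpace ℝ (Fin m))) : Prop :=
  ∃ a b, a ≠ b ∧ G = segment ℝ a b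

/-- A (non-degenerate) filled ellipse: the image of the closed unit disk of the Euclidean plane
under an injective affine map. -/
def IsFilledEllipse {m : ℕ} (G : Set (EuclideanSpace ℝ (Fin m))) : Prop :=
  ∃ f : EuclideanSpace ℝ (Fin 2) →ᵃ[ℝ] EuclideanSpace ℝ (Fin m),
    Function.Injective f ∧ G = f '' Metric.closedBall 0 1

/-- The set of large faces of `L(F)`: the exposed faces different from `L(F)` which are segments
or filled ellipses. (`IsExposed ℝ C G` says that `G` is empty or the set of all maximizers on `C`
of some linear functional.) -/
def largeFaces {d n : ℕ} (F : Fin n → Matrix (Fin d) (Fin d) ℂ) :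
    Set (Set (EuclideanSpace ℝ (Fin n))) :=
  {G | IsExposed ℝ (jointAlgebraicNumericalRange F) G ∧ G ≠ jointAlgebraicNumericalRange F ∧
    (IsSegment G ∨ IsFilledEllipse G)}

/-- The normal cone of `C` at `x`. -/
def normalCone {m : ℕ} (C : Set (EuclideanSpace ℝ (Fin m))) (x : EuclideanSpace ℝ (Fin m)) :
    Set (EuclideanSpace ℝ (Fin m)) :=
  {u | ∀ y ∈ C, inner ℝ u (y - x) ≤ 0}

/-- `x` is a corner point of `C ⊆ ℝᵐ`: a point of `C` whose normal cone has dimension `m`, the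
dimension of a convex set being the dimension of its affine hull. -/
def IsCornerPoint {m : ℕ} (C : Set (EuclideanSpace ℝ (Fin m))) (x : EuclideanSpace ℝ (Fin m)) :
    Prop :=
  x ∈ C ∧ Module.finrank ℝ (vectorSpan ℝ (normalCone C x)) = m

/-!
A face of the numerical range exposed by a functional `l` with maximum `c` is the image of the
states supported on the largest eigenspace of `∑ i, lᵢ Fᵢ` (`faceSpace`,
`apply_sum_vectorValue_eq_iff`). For `3 × 3` matrices a proper face which is a segment has an
eigenspace of dimension exactly two (`finrank_faceSpace_eq_two`). Two different planes `V₁`, `V₂` in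
`ℂ³` meet in a line, spanned by a unit vector `e`; hence the two faces meet in the single point `p`
given by the state of `e`.

The functional exposing one face has `e` as an eigenvector and is not constant on the other face.
As the other face is a segment, all the `Fᵢ` compressed to its plane are diagonal together with that
functional, so `⟨e, Fᵢ w⟩ = 0` for all `w` in the plane orthogonal to `e`
(`inner_apply_eq_zero_of_segment`). Since `V₁ + V₂ = ℂ³`, the vector `e` is a common eigenvector of
the `Fᵢ` (`toEuclideanLin_apply_eq_smul`), so the numerical range is the convex hull of `p` and of
the values on the orthogonal complement of `e`. The sum of the two exposing functionals is strictly
smaller there than at `p`, which persists under small perturbations, so the normal cone at `p` has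
nonempty interior (`isCornerPoint_vectorValue`).
-/

/-! ### Values of vectors and the numerical range -/

lemma norm_ofReal_inv_norm_smul {E : Type*} [NormedAddCommGroup E] [NormedSpace ℂ E] {x : E}
    (hx : x ≠ 0) : ‖((‖x‖⁻¹ : ℝ) : ℂ) • x‖ = 1 := by
  rw [norm_smul, Complex.norm_real, norm_inv, norm_norm, inv_mul_cancel₀ (norm_ne_zero_iff.2 hx)]

lemma Submodule.exists_smul_eq_of_finrank_le_one {K E : Type*} [Field K] [AddCommGroup E]
    [Module K E] [FiniteDimensional K E] {W : Submodule K E} (hW : Module.finrank K W ≤ 1)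
    {e y : E} (he : e ∈ W) (he0 : e ≠ 0) (hy : y ∈ W) : ∃ z : K, z • e = y := by
  obtain ⟨v, hv⟩ := finrank_le_one_iff.1 hW
  obtain ⟨r, hr⟩ := hv ⟨e, he⟩
  obtain ⟨s, hs⟩ := hv ⟨y, hy⟩
  have hr' : r • (v : E) = e := congrArg Subtype.val hr
  have hs' : s • (v : E) = y := congrArg Subtype.val hs
  have hr0 : r ≠ 0 := by
    rintro rfl
    exact he0 (by rw [← hr', zero_smul])
  exact ⟨s / r, by rw [← hr', smul_smul, div_mul_cancel₀ _ hr0, hs']⟩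

/-- The point `(⟨x, F₁ x⟩, …, ⟨x, Fₙ x⟩)`, without normalising `x`: for a unit vector this is a
point of the joint numerical range, and in general it scales with `‖x‖ ^ 2`. -/
noncomputable def vectorValue {d n : ℕ} (F : Fin n → Matrix (Fin d) (Fin d) ℂ)
    (x : EuclideanSpace ℂ (Fin d)) : EuclideanSpace ℝ (Fin n) :=
  WithLp.toLp 2 fun i => (inner ℂ x ((F i).toEuclideanLin x)).re

section vectorValue

variable {d n : ℕ} {F : Fin n → Matrix (Fin d) (Fin d) ℂ}

lemma vectorValue_apply (x : EuclideanSpace ℂ (Fin d)) (i : Fin n) :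
    vectorValue F x i = (inner ℂ x ((F i).toEuclideanLin x)).re := rfl

lemma vectorValue_smul (z : ℂ) (x : EuclideanSpace ℂ (Fin d)) :
    vectorValue F (z • x) = ‖z‖ ^ 2 • vectorValue F x := by
  ext i
  rw [PiLp.smul_apply, vectorValue_apply, vectorValue_apply, map_smul, inner_smul_left,
    inner_smul_right, ← mul_assoc, mul_comm (starRingEnd ℂ z), Complex.mul_conj,
    Complex.re_ofReal_mul, Complex.normSq_eq_norm_sq, smul_eq_mul]

lemma vectorValue_zero : vectorValue F 0 = 0 := by
  simpa using vectorValue_smul (F := F) 0 0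

lemma vectorValue_neg (x : EuclideanSpace ℂ (Fin d)) : vectorValue F (-x) = vectorValue F x := by
  simpa using vectorValue_smul (F := F) (-1) x

lemma vectorValue_add_apply (hF : ∀ i, (F i).IsHermitian) (x y : EuclideanSpace ℂ (Fin d))
    (i : Fin n) : vectorValue F (x + y) i =
      vectorValue F x i + vectorValue F y i + 2 * (inner ℂ x ((F i).toEuclideanLin y)).re := by
  have h : (inner ℂ y ((F i).toEuclideanLin x)).re = (inner ℂ x ((F i).toEuclideanLin y)).re := by
    rw [← (Matrix.isSymmetric_toEuclideanLin_iff.2 (hF i)) y x, ← inner_conj_symm, Complex.conj_re]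
  simp only [vectorValue_apply, map_add, inner_add_left, inner_add_right, Complex.add_re, h]
  ring

lemma continuous_vectorValue : Continuous (vectorValue F) := by
  refine (PiLp.continuous_toLp 2 _).comp (continuous_pi fun i => ?_)
  have := (LinearMap.continuous_of_finiteDimensional (F i).toEuclideanLin)
  fun_prop

/-- A factorisation `ρ = Bᴴ * B` writes `ρ` as the sum of `b * bᴴ` over the conjugated rows `b`
of `B`. -/
lemma expectation_conjTranspose_mul_self (B : Matrix (Fin d) (Fin d) ℂ) :
    expectation F (B.conjTranspose * B) =
      ∑ k, vectorValue F (WithLp.toLp 2 fun j => star (B k j)) := by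
  ext i
  rw [WithLp.ofLp_sum, Finset.sum_apply]
  simp only [vectorValue_apply, expectation]
  rw [Matrix.conjTranspose_mul, Matrix.conjTranspose_conjTranspose, Matrix.mul_assoc,
    Matrix.trace_mul_comm, Matrix.mul_assoc, Matrix.trace, Complex.re_sum]
  refine Finset.sum_congr rfl fun k _ => ?_
  rw [Matrix.diag_apply, EuclideanSpace.inner_eq_star_dotProduct, Matrix.mul_apply]
  simp [dotProduct, Matrix.mulVec, Matrix.mul_apply, mul_comm]

lemma trace_conjTranspose_mul_self_eq_sum (B : Matrix (Fin d) (Fin d) ℂ) :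
    (B.conjTranspose * B).trace =
      ((∑ k, ‖(WithLp.toLp 2 fun j => star (B k j) : EuclideanSpace ℂ (Fin d))‖ ^ 2 : ℝ) : ℂ) := by
  rw [Matrix.trace_mul_comm, Matrix.trace]
  push_cast
  refine Finset.sum_congr rfl fun k _ => ?_
  rw [← Complex.ofReal_pow, EuclideanSpace.norm_sq_eq, Matrix.diag_apply, Matrix.mul_apply]
  push_cast
  refine Finset.sum_congr rfl fun j _ => ?_
  simp [Complex.mul_conj']

open scoped ComplexOrder MatrixOrder Matrix.Norms.L2Operator in
/-- The range consists of the sums of `d` vector values with total squared norm one. Not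
normalising the vectors makes any factorisation of the state good enough, so that no spectral
decomposition is needed. -/
lemma mem_jointAlgebraicNumericalRange_iff {y : EuclideanSpace ℝ (Fin n)} :
    y ∈ jointAlgebraicNumericalRange F ↔ ∃ b : Fin d → EuclideanSpace ℂ (Fin d),
      ∑ k, ‖b k‖ ^ 2 = 1 ∧ ∑ k, vectorValue F (b k) = y := by
  constructor
  · rintro ⟨ρ, ⟨hρ, htr⟩, rfl⟩
    obtain ⟨B, rfl⟩ := CStarAlgebra.nonneg_iff_eq_star_mul_self.1 hρ.nonneg
    refine ⟨fun k => WithLp.toLp 2 fun j => star (B k j), ?_, ?_⟩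
    · rw [Matrix.star_eq_conjTranspose, trace_conjTranspose_mul_self_eq_sum] at htr
      exact_mod_cast htr
    · exact (expectation_conjTranspose_mul_self B).symm
  · rintro ⟨b, hb, rfl⟩
    let B : Matrix (Fin d) (Fin d) ℂ := fun k j => star (b k j)
    have hB : ∀ k, (WithLp.toLp 2 fun j => star (B k j) : EuclideanSpace ℂ (Fin d)) = b k :=
      fun k => by ext j; simp [B]
    refine ⟨B.conjTranspose * B, ⟨Matrix.posSemidef_conjTranspose_mul_self B, ?_⟩, ?_⟩
    · rw [trace_conjTranspose_mul_self_eq_sum]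
      simp only [hB, hb, Complex.ofReal_one]
    · rw [expectation_conjTranspose_mul_self]
      simp only [hB]

lemma vectorValue_mem {x : EuclideanSpace ℂ (Fin d)} (hx : ‖x‖ = 1) :
    vectorValue F x ∈ jointAlgebraicNumericalRange F := by
  have hd : 0 < d := by
    rcases Nat.eq_zero_or_pos d with rfl | h
    · rw [Subsingleton.elim x 0, norm_zero] at hx
      exact absurd hx zero_ne_one
    · exact h
  refine mem_jointAlgebraicNumericalRange_iff.2 ⟨Pi.single ⟨0, hd⟩ x, ?_, ?_⟩
  · rw [Finset.sum_eq_single ⟨0, hd⟩] <;> simp +contextual [hx]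
  · rw [Finset.sum_eq_single ⟨0, hd⟩] <;> simp +contextual [vectorValue_zero]

lemma vectorValue_normalize_mem {x : EuclideanSpace ℂ (Fin d)} (hx : x ≠ 0) :
    (‖x‖ ^ 2)⁻¹ • vectorValue F x ∈ jointAlgebraicNumericalRange F := by
  have h := vectorValue_mem (F := F) (norm_ofReal_inv_norm_smul hx)
  rwa [vectorValue_smul, Complex.norm_real, norm_inv, norm_norm, inv_pow] at h

end vectorValue

/-! ### The subspace of an exposed face -/

section faces

variable {d n : ℕ} {F : Fin n → Matrix (Fin d) (Fin d) ℂ}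

/-- A nonempty exposed face is the level set of a functional at a value `c` which bounds the
functional homogeneously, on the values of all vectors. -/
lemma IsExposed.exists_eq_level {G : Set (EuclideanSpace ℝ (Fin n))}
    (hG : IsExposed ℝ (jointAlgebraicNumericalRange F) G) (hne : G.Nonempty) :
    ∃ (l : StrongDual ℝ (EuclideanSpace ℝ (Fin n))) (c : ℝ),
      (∀ x, l (vectorValue F x) ≤ c * ‖x‖ ^ 2) ∧
        G = {y ∈ jointAlgebraicNumericalRange F | l y = c} := by
  obtain ⟨l, rfl⟩ := hG hne
  obtain ⟨g, hg, hmax⟩ := hne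
  refine ⟨l, l g, fun x => ?_, ?_⟩
  · rcases eq_or_ne x 0 with rfl | hx
    · simp [vectorValue_zero]
    · have h := hmax _ (vectorValue_normalize_mem hx)
      rwa [map_smul, smul_eq_mul, inv_mul_le_iff₀ (by positivity), mul_comm] at h
  · ext y
    exact and_congr_right fun hy =>
      ⟨fun h => le_antisymm (hmax y hy) (h g hg), fun h z hz => h ▸ hmax z hz⟩

/-- The matrix `c - ∑ i, lᵢ Fᵢ`, where the `lᵢ` are the coordinates of `l`. If `c` is the maximum of
`l` on the numerical range, it is positive semi-definite. -/
noncomputable def gapMatrix (F : Fin n → Matrix (Fin d) (Fin d) ℂ)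
    (l : StrongDual ℝ (EuclideanSpace ℝ (Fin n))) (c : ℝ) : Matrix (Fin d) (Fin d) ℂ :=
  (c : ℂ) • 1 - ∑ i, ((l (EuclideanSpace.single i 1) : ℝ) : ℂ) • F i

/-- The kernel of `gapMatrix F l c`. If `c` is the maximum of `l` on the numerical range, this is
the eigenspace of `∑ i, lᵢ Fᵢ` for its largest eigenvalue, and the states supported on it are those
which map to the face `l = c`. -/
noncomputable def faceSpace (F : Fin n → Matrix (Fin d) (Fin d) ℂ)
    (l : StrongDual ℝ (EuclideanSpace ℝ (Fin n))) (c : ℝ) :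
    Submodule ℂ (EuclideanSpace ℂ (Fin d)) :=
  LinearMap.ker (gapMatrix F l c).toEuclideanLin

lemma isHermitian_gapMatrix (hF : ∀ i, (F i).IsHermitian)
    (l : StrongDual ℝ (EuclideanSpace ℝ (Fin n))) (c : ℝ) : (gapMatrix F l c).IsHermitian := by
  rw [Matrix.IsHermitian, gapMatrix, Matrix.conjTranspose_sub, Matrix.conjTranspose_sum]
  simp [Matrix.conjTranspose_smul, (hF _).eq]

lemma re_inner_gapMatrix (l : StrongDual ℝ (EuclideanSpace ℝ (Fin n))) (c : ℝ)
    (x : EuclideanSpace ℂ (Fin d)) :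
    (inner ℂ x ((gapMatrix F l c).toEuclideanLin x)).re = c * ‖x‖ ^ 2 - l (vectorValue F x) := by
  have hl : l (vectorValue F x) = ∑ i, l (EuclideanSpace.single i 1) * vectorValue F x i := by
    conv_lhs => rw [← (EuclideanSpace.basisFun (Fin n) ℝ).sum_repr (vectorValue F x)]
    simp [mul_comm]
  have h1 : Matrix.toEuclideanLin (1 : Matrix (Fin d) (Fin d) ℂ) x = x := by
    simp
  rw [hl, gapMatrix, map_sub, map_smul, map_sum, LinearMap.sub_apply, LinearMap.smul_apply, h1,
    LinearMap.sum_apply, inner_sub_right, inner_smul_right, inner_sum, Complex.sub_re,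
    Complex.re_ofReal_mul, Complex.re_sum, inner_self_eq_norm_sq_to_K]
  congr 1
  · norm_cast
  · refine Finset.sum_congr rfl fun i _ => ?_
    rw [map_smul, LinearMap.smul_apply, inner_smul_right, Complex.re_ofReal_mul, vectorValue_apply]

variable {l : StrongDual ℝ (EuclideanSpace ℝ (Fin n))} {c : ℝ}

open scoped ComplexOrder in
lemma mem_faceSpace_iff (hF : ∀ i, (F i).IsHermitian)
    (hl : ∀ x, l (vectorValue F x) ≤ c * ‖x‖ ^ 2) {x : EuclideanSpace ℂ (Fin d)} :
    x ∈ faceSpace F l c ↔ l (vectorValue F x) = c * ‖x‖ ^ 2 := by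
  have hsymm := Matrix.isSymmetric_toEuclideanLin_iff.2 (isHermitian_gapMatrix hF l c)
  have hpos : (gapMatrix F l c).PosSemidef := by
    rw [← Matrix.isPositive_toEuclideanLin_iff]
    refine ⟨hsymm, fun y => ?_⟩
    rw [hsymm y y]
    have := re_inner_gapMatrix (F := F) l c y
    have h2 := hl y
    change 0 ≤ (inner ℂ y ((gapMatrix F l c).toEuclideanLin y)).re
    linarith
  rw [faceSpace, LinearMap.mem_ker]
  constructor
  · intro h
    have := re_inner_gapMatrix (F := F) l c x
    rw [h, inner_zero_right, Complex.zero_re] at this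
    linarith
  · intro h
    have h0 := re_inner_gapMatrix (F := F) l c x
    rw [h, sub_self] at h0
    have him : (inner ℂ x ((gapMatrix F l c).toEuclideanLin x)).im = 0 := by
      have := hsymm.im_inner_self_apply x
      simpa using this
    have hz : inner ℂ x ((gapMatrix F l c).toEuclideanLin x) = 0 := Complex.ext h0 him
    have := (hpos.dotProduct_mulVec_zero_iff x.ofLp).1 (by
      rw [EuclideanSpace.inner_eq_star_dotProduct, dotProduct_comm] at hz
      exact hz)
    rw [Matrix.toLpLin_apply, this]
    rfl

/-- The quadratic form of `gapMatrix F l c` has no cross terms with vectors of its kernel. -/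
lemma apply_vectorValue_add (hF : ∀ i, (F i).IsHermitian) {e : EuclideanSpace ℂ (Fin d)}
    (he : e ∈ faceSpace F l c) (w : EuclideanSpace ℂ (Fin d)) :
    c * ‖e + w‖ ^ 2 - l (vectorValue F (e + w)) = c * ‖w‖ ^ 2 - l (vectorValue F w) := by
  have he' : (gapMatrix F l c).toEuclideanLin e = 0 := he
  have hsymm := Matrix.isSymmetric_toEuclideanLin_iff.2 (isHermitian_gapMatrix hF l c)
  rw [← re_inner_gapMatrix, ← re_inner_gapMatrix, map_add, he', zero_add, inner_add_left,
    ← hsymm e w, he', inner_zero_left, zero_add]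

lemma apply_sum_vectorValue_eq_iff (hF : ∀ i, (F i).IsHermitian)
    (hl : ∀ x, l (vectorValue F x) ≤ c * ‖x‖ ^ 2) {b : Fin d → EuclideanSpace ℂ (Fin d)}
    (hb : ∑ k, ‖b k‖ ^ 2 = 1) :
    l (∑ k, vectorValue F (b k)) = c ↔ ∀ k, b k ∈ faceSpace F l c := by
  have hc : c = ∑ k, c * ‖b k‖ ^ 2 := by rw [← Finset.mul_sum, hb, mul_one]
  rw [map_sum]
  conv_lhs => rw [hc]
  rw [Finset.sum_eq_sum_iff_of_le fun k _ => hl (b k)]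
  simp [mem_faceSpace_iff hF hl]

lemma sum_vectorValue_eq_of_finrank_le_one {W : Submodule ℂ (EuclideanSpace ℂ (Fin d))}
    (hW : Module.finrank ℂ W ≤ 1) {e : EuclideanSpace ℂ (Fin d)} (he : e ∈ W) (hn : ‖e‖ = 1)
    {b : Fin d → EuclideanSpace ℂ (Fin d)} (hb : ∑ k, ‖b k‖ ^ 2 = 1) (hbW : ∀ k, b k ∈ W) :
    ∑ k, vectorValue F (b k) = vectorValue F e := by
  have he0 : e ≠ 0 := fun h => by simp [h] at hn
  have key : ∀ k, vectorValue F (b k) = ‖b k‖ ^ 2 • vectorValue F e := by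
    intro k
    obtain ⟨z, hz⟩ := Submodule.exists_smul_eq_of_finrank_le_one hW he he0 (hbW k)
    rw [← hz, vectorValue_smul, norm_smul, hn, mul_one]
  rw [Finset.sum_congr rfl fun k _ => key k, ← Finset.sum_smul, hb, one_smul]

end faces

/-! ### Segments come from two-dimensional subspaces -/

section dimension

variable {n : ℕ} {F : Fin n → Matrix (Fin 3) (Fin 3) ℂ}
  {l : StrongDual ℝ (EuclideanSpace ℝ (Fin n))} {c : ℝ}

/-- A subspace of dimension at most one yields a single point, and the whole space yields the whole
numerical range. -/
lemma finrank_faceSpace_eq_two (hF : ∀ i, (F i).IsHermitian)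
    (hl : ∀ x, l (vectorValue F x) ≤ c * ‖x‖ ^ 2)
    (hs : IsSegment {y ∈ jointAlgebraicNumericalRange F | l y = c})
    (hne : {y ∈ jointAlgebraicNumericalRange F | l y = c} ≠ jointAlgebraicNumericalRange F) :
    Module.finrank ℂ (faceSpace F l c) = 2 := by
  have hlt : Module.finrank ℂ (faceSpace F l c) < 3 := by
    have h3 : Module.finrank ℂ (EuclideanSpace ℂ (Fin 3)) = 3 := by simp
    refine (Submodule.finrank_lt fun htop =>
      hne (Set.sep_eq_self_iff_mem_true.2 fun y hy => ?_)).trans_eq h3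
    obtain ⟨b, hb, rfl⟩ := mem_jointAlgebraicNumericalRange_iff.1 hy
    exact (apply_sum_vectorValue_eq_iff hF hl hb).2 fun k => htop ▸ Submodule.mem_top
  have hgt : 1 < Module.finrank ℂ (faceSpace F l c) := by
    by_contra! hle
    obtain ⟨a, a', haa', hG⟩ := hs
    have hmem : ∀ y ∈ segment ℝ a a', ∃ b : Fin 3 → EuclideanSpace ℂ (Fin 3),
        ∑ k, ‖b k‖ ^ 2 = 1 ∧ ∑ k, vectorValue F (b k) = y ∧ ∀ k, b k ∈ faceSpace F l c := by
      intro y hy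
      rw [← hG] at hy
      obtain ⟨b, hb, rfl⟩ := mem_jointAlgebraicNumericalRange_iff.1 hy.1
      exact ⟨b, hb, rfl, (apply_sum_vectorValue_eq_iff hF hl hb).1 hy.2⟩
    obtain ⟨b, hb, hba, hbV⟩ := hmem a (left_mem_segment ℝ a a')
    obtain ⟨b', hb', hba', hbV'⟩ := hmem a' (right_mem_segment ℝ a a')
    obtain ⟨k, -, hk⟩ : ∃ k ∈ Finset.univ, ‖b k‖ ^ 2 ≠ 0 :=
      Finset.exists_ne_zero_of_sum_ne_zero (by rw [hb]; exact one_ne_zero)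
    have hk0 : b k ≠ 0 := fun h => hk (by simp [h])
    have hmemV : ((‖b k‖⁻¹ : ℝ) : ℂ) • b k ∈ faceSpace F l c := Submodule.smul_mem _ _ (hbV k)
    have hnorm : ‖((‖b k‖⁻¹ : ℝ) : ℂ) • b k‖ = 1 := norm_ofReal_inv_norm_smul hk0
    exact haa' (by rw [← hba, ← hba', sum_vectorValue_eq_of_finrank_le_one hle hmemV hnorm hb hbV,
      sum_vectorValue_eq_of_finrank_le_one hle hmemV hnorm hb' hbV'])
  omega

end dimension

/-! ### A common eigenvector -/

section splitting

variable {d n : ℕ} {F : Fin n → Matrix (Fin d) (Fin d) ℂ}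
  {l l' : StrongDual ℝ (EuclideanSpace ℝ (Fin n))} {c c' : ℝ}

/-- The normalised values of `e + w` and `e - w` lie on the segment, and `l'`, which is injective on
the segment, does not distinguish them because `e` is in the kernel of the gap matrix of `l'`.
So the values agree, and their difference is the real part of the cross term. -/
lemma inner_apply_eq_zero_of_segment (hF : ∀ i, (F i).IsHermitian)
    (hl : ∀ x, l (vectorValue F x) ≤ c * ‖x‖ ^ 2) {a b : EuclideanSpace ℝ (Fin n)}
    (hG : {y ∈ jointAlgebraicNumericalRange F | l y = c} = segment ℝ a b) (hab : l' a ≠ l' b)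
    {e : EuclideanSpace ℂ (Fin d)} (he : e ∈ faceSpace F l c) (he' : e ∈ faceSpace F l' c')
    (he0 : e ≠ 0) {w : EuclideanSpace ℂ (Fin d)} (hw : w ∈ faceSpace F l c)
    (hew : inner ℂ e w = 0) (i : Fin n) : inner ℂ e ((F i).toEuclideanLin w) = 0 := by
  have hre : ∀ w ∈ faceSpace F l c, inner ℂ e w = 0 →
      (inner ℂ e ((F i).toEuclideanLin w)).re = 0 := by
    intro w hw hew
    have hne : ∀ v : EuclideanSpace ℂ (Fin d), inner ℂ e v = 0 → e + v ≠ 0 := by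
      intro v hv h
      have : inner ℂ e (e + v) = 0 := by rw [h, inner_zero_right]
      rw [inner_add_right, hv, add_zero] at this
      exact he0 (inner_self_eq_zero.1 this)
    have hew' : inner ℂ e (-w) = 0 := by rw [inner_neg_right, hew, neg_zero]
    have hseg : ∀ v ∈ faceSpace F l c, inner ℂ e v = 0 →
        ∃ t : ℝ, (‖e + v‖ ^ 2)⁻¹ • vectorValue F (e + v) = a + t • (b - a) := by
      intro v hv hev
      have hmem : (‖e + v‖ ^ 2)⁻¹ • vectorValue F (e + v) ∈ segment ℝ a b := by
        rw [← hG]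
        refine ⟨vectorValue_normalize_mem (hne v hev), ?_⟩
        have hpos : ‖e + v‖ ^ 2 ≠ 0 := pow_ne_zero _ (norm_ne_zero_iff.2 (hne v hev))
        rw [map_smul, (mem_faceSpace_iff hF hl).1 (Submodule.add_mem _ he hv), smul_eq_mul,
          mul_comm c, inv_mul_cancel_left₀ hpos]
      rw [segment_eq_image'] at hmem
      obtain ⟨t, -, ht⟩ := hmem
      exact ⟨t, ht.symm⟩
    obtain ⟨t, ht⟩ := hseg w hw hew
    obtain ⟨s, hs⟩ := hseg (-w) (Submodule.neg_mem _ hw) hew'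
    have hnormeq : ‖e + w‖ = ‖e + -w‖ := by
      have h1 := norm_add_sq_eq_norm_sq_add_norm_sq_of_inner_eq_zero e w hew
      have h2 := norm_add_sq_eq_norm_sq_add_norm_sq_of_inner_eq_zero e (-w) hew'
      rw [norm_neg, ← h1] at h2
      nlinarith [norm_nonneg (e + w), norm_nonneg (e + -w)]
    have hl' : l' (vectorValue F (e + w)) = l' (vectorValue F (e + -w)) := by
      have h1 := apply_vectorValue_add hF he' w
      have h2 := apply_vectorValue_add hF he' (-w)
      rw [vectorValue_neg, norm_neg, ← hnormeq] at h2
      linarith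
    have hts : t = s := by
      have h1 := congrArg l' ht
      have h2 := congrArg l' hs
      rw [map_smul, map_add, map_smul, map_sub, smul_eq_mul, smul_eq_mul] at h1 h2
      rw [← hnormeq, ← hl', h1] at h2
      exact mul_right_cancel₀ (sub_ne_zero.2 hab.symm) (add_left_cancel h2)
    have heq : vectorValue F (e + w) = vectorValue F (e + -w) := by
      rw [← hts, ← ht, ← hnormeq] at hs
      exact (smul_right_injective _
        (inv_ne_zero (pow_ne_zero 2 (norm_ne_zero_iff.2 (hne w hew)))) hs).symm
    have := congrArg (fun y : EuclideanSpace ℝ (Fin n) => y i) heq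
    simp only [vectorValue_add_apply hF, vectorValue_neg, map_neg, inner_neg_right,
      Complex.neg_re] at this
    linarith
  refine Complex.ext (hre w hw hew) ?_
  -- The imaginary part is the real part for `I • w`, up to sign.
  have := hre (Complex.I • w) (Submodule.smul_mem _ _ hw) (by rw [inner_smul_right, hew, mul_zero])
  rw [map_smul, inner_smul_right, Complex.I_mul_re] at this
  rw [Complex.zero_im]
  linarith

/-- `F i e - ⟨e, F i e⟩ e` is orthogonal to both `V` and `W`. -/
lemma toEuclideanLin_apply_eq_smul (hF : ∀ i, (F i).IsHermitian) {e : EuclideanSpace ℂ (Fin d)}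
    (hn : ‖e‖ = 1) {V W : Submodule ℂ (EuclideanSpace ℂ (Fin d))} (hV : e ∈ V) (hW : e ∈ W)
    (htop : V ⊔ W = ⊤) {i : Fin n}
    (hVw : ∀ w ∈ V, inner ℂ e w = 0 → inner ℂ e ((F i).toEuclideanLin w) = 0)
    (hWw : ∀ w ∈ W, inner ℂ e w = 0 → inner ℂ e ((F i).toEuclideanLin w) = 0) :
    (F i).toEuclideanLin e = (vectorValue F e i : ℂ) • e := by
  have hsymm := Matrix.isSymmetric_toEuclideanLin_iff.2 (hF i)
  have hval : inner ℂ e ((F i).toEuclideanLin e) = (vectorValue F e i : ℂ) := by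
    refine Complex.ext (by rw [Complex.ofReal_re, vectorValue_apply]) ?_
    rw [Complex.ofReal_im]
    have := hsymm.im_inner_self_apply e
    simpa using this
  have hee : inner ℂ e e = (1 : ℂ) := by rw [inner_self_eq_norm_sq_to_K, hn]; simp
  have key : ∀ U : Submodule ℂ (EuclideanSpace ℂ (Fin d)), e ∈ U →
      (∀ w ∈ U, inner ℂ e w = 0 → inner ℂ e ((F i).toEuclideanLin w) = 0) →
      (F i).toEuclideanLin e - (vectorValue F e i : ℂ) • e ∈ Uᗮ := by
    intro U heU hU
    rw [Submodule.mem_orthogonal']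
    intro x hx
    have horth : inner ℂ e (x - inner ℂ e x • e) = 0 := by
      rw [inner_sub_right, inner_smul_right, hee, mul_one, sub_self]
    have h0 := hU _ (Submodule.sub_mem _ hx (Submodule.smul_mem _ (inner ℂ e x) heU)) horth
    rw [map_sub, map_smul, inner_sub_right, inner_smul_right, hval] at h0
    rw [inner_sub_left, inner_smul_left, Complex.conj_ofReal, hsymm e x]
    linear_combination h0
  have hmem : (F i).toEuclideanLin e - (vectorValue F e i : ℂ) • e ∈ (V ⊔ W)ᗮ := by
    rw [← Submodule.inf_orthogonal]
    exact ⟨key V hV hVw, key W hW hWw⟩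
  rw [htop, Submodule.top_orthogonal_eq_bot, Submodule.mem_bot] at hmem
  exact sub_eq_zero.1 hmem

end splitting

/-! ### Corner points from common eigenvectors -/

section corner

variable {d n : ℕ} {F : Fin n → Matrix (Fin d) (Fin d) ℂ}

lemma vectorValue_smul_add (hF : ∀ i, (F i).IsHermitian) {e : EuclideanSpace ℂ (Fin d)}
    (he : ∀ i, (F i).toEuclideanLin e = (vectorValue F e i : ℂ) • e) (z : ℂ)
    {y : EuclideanSpace ℂ (Fin d)} (hy : inner ℂ e y = 0) :
    vectorValue F (z • e + y) = ‖z‖ ^ 2 • vectorValue F e + vectorValue F y := by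
  ext i
  rw [vectorValue_add_apply hF, vectorValue_smul, ← Matrix.isSymmetric_toEuclideanLin_iff.2 (hF i),
    map_smul, he, inner_smul_left, inner_smul_left, hy]
  simp

/-- For a common unit eigenvector `e`, a functional whose value at `e` exceeds its values at the
unit vectors orthogonal to `e` is an interior point of the normal cone, by compactness of the unit
sphere of the orthogonal complement. -/
lemma isCornerPoint_vectorValue (hF : ∀ i, (F i).IsHermitian) {e : EuclideanSpace ℂ (Fin d)}
    (hn : ‖e‖ = 1) (he : ∀ i, (F i).toEuclideanLin e = (vectorValue F e i : ℂ) • e)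
    {l : StrongDual ℝ (EuclideanSpace ℝ (Fin n))}
    (hl : ∀ y, ‖y‖ = 1 → inner ℂ e y = 0 → l (vectorValue F y) < l (vectorValue F e)) :
    IsCornerPoint (jointAlgebraicNumericalRange F) (vectorValue F e) := by
  set u₀ := (InnerProductSpace.toDual ℝ _).symm l with hu₀
  have hK : IsCompact {y : EuclideanSpace ℂ (Fin d) | ‖y‖ = 1 ∧ inner ℂ e y = 0} := by
    have h1 : IsClosed {y : EuclideanSpace ℂ (Fin d) | inner ℂ e y = 0} :=
      isClosed_eq (by fun_prop) continuous_const
    have h2 := (isCompact_sphere (0 : EuclideanSpace ℂ (Fin d)) 1).inter_right h1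
    simpa only [Set.ext_iff, Set.inter_def, mem_sphere_zero_iff_norm, Set.mem_ofPred_eq] using h2
  have hev : ∀ᶠ u in nhds u₀, ∀ y ∈ {y : EuclideanSpace ℂ (Fin d) | ‖y‖ = 1 ∧ inner ℂ e y = 0},
      inner ℝ u (vectorValue F y - vectorValue F e) < 0 := by
    refine hK.eventually_forall_of_forall_eventually fun y hy => ?_
    have hcont : Continuous fun z : EuclideanSpace ℝ (Fin n) × EuclideanSpace ℂ (Fin d) =>
        inner ℝ z.1 (vectorValue F z.2 - vectorValue F e) :=
      continuous_fst.inner ((continuous_vectorValue.comp continuous_snd).sub continuous_const)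
    refine hcont.continuousAt.eventually_lt_const ?_
    simp only [hu₀, InnerProductSpace.toDual_symm_apply, map_sub]
    linarith [hl y hy.1 hy.2]
  have hcone : ∀ᶠ u in nhds u₀,
      u ∈ normalCone (jointAlgebraicNumericalRange F) (vectorValue F e) := by
    filter_upwards [hev] with u hu y hy
    obtain ⟨b, hb, rfl⟩ := mem_jointAlgebraicNumericalRange_iff.1 hy
    have hsum : ∑ k, vectorValue F (b k) - vectorValue F e =
        ∑ k, (vectorValue F (b k) - ‖b k‖ ^ 2 • vectorValue F e) := by
      rw [Finset.sum_sub_distrib, ← Finset.sum_smul, hb, one_smul]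
    rw [hsum, inner_sum]
    -- Split `x` along `e`: only the component `v` orthogonal to `e` contributes.
    refine Finset.sum_nonpos fun k _ => ?_
    set x := b k
    have hee : inner ℂ e e = (1 : ℂ) := by rw [inner_self_eq_norm_sq_to_K, hn]; simp
    set z : ℂ := inner ℂ e x
    set v := x - z • e with hv
    have hev : inner ℂ e v = 0 := by
      rw [hv, inner_sub_right, inner_smul_right, hee, mul_one, sub_self]
    have hx : x = z • e + v := by rw [hv]; abel
    have hnorm : ‖x‖ ^ 2 = ‖z‖ ^ 2 + ‖v‖ ^ 2 := by
      have := norm_add_sq_eq_norm_sq_add_norm_sq_of_inner_eq_zero (z • e) v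
        (by rw [inner_smul_left, hev, mul_zero])
      rw [hx]
      rw [norm_smul, hn, mul_one] at this
      linarith
    have hdiff : vectorValue F x - ‖x‖ ^ 2 • vectorValue F e =
        vectorValue F v - ‖v‖ ^ 2 • vectorValue F e := by
      rw [hnorm, hx, vectorValue_smul_add hF he z hev, add_smul]
      abel
    rw [hdiff]
    rcases eq_or_ne v 0 with h0 | h0
    · simp [h0, vectorValue_zero]
    · have hpos : 0 < ‖v‖ := norm_pos_iff.2 h0
      have h := hu (((‖v‖⁻¹ : ℝ) : ℂ) • v) ⟨norm_ofReal_inv_norm_smul h0,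
        by rw [inner_smul_right, hev, mul_zero]⟩
      have hs : vectorValue F v - ‖v‖ ^ 2 • vectorValue F e =
          ‖v‖ ^ 2 • (vectorValue F (((‖v‖⁻¹ : ℝ) : ℂ) • v) - vectorValue F e) := by
        rw [vectorValue_smul, smul_sub, smul_smul, Complex.norm_real, norm_inv, norm_norm,
          ← mul_pow, mul_inv_cancel₀ hpos.ne', one_pow, one_smul]
      rw [hs, inner_smul_right]
      exact mul_nonpos_of_nonneg_of_nonpos (by positivity) h.le
  refine ⟨vectorValue_mem hn, ?_⟩
  have hspan : affineSpan ℝ (normalCone (jointAlgebraicNumericalRange F) (vectorValue F e)) = ⊤ :=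
    affineSpan_eq_top_of_nonempty_interior
      ⟨u₀, interior_mono (subset_convexHull ℝ _) (mem_interior_iff_mem_nhds.2 hcone)⟩
  rw [AffineSubspace.vectorSpan_eq_top_of_affineSpan_eq_top ℝ _ _ hspan, finrank_top,
    finrank_euclideanSpace_fin]

end corner

/-! ### Two segments meet in a corner point -/

theorem lemma5p4 (F : Fin 3 → Matrix (Fin 3) (Fin 3) ℂ) (hF : ∀ i, (F i).IsHermitian)
    (G₁ G₂ : Set (EuclideanSpace ℝ (Fin 3)))
    (hG₁ : G₁ ∈ largeFaces F) (hG₂ : G₂ ∈ largeFaces F)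
    (hs₁ : IsSegment G₁) (hs₂ : IsSegment G₂) (hne : G₁ ≠ G₂) :
    ∃ p, G₁ ∩ G₂ = {p} ∧ IsCornerPoint (jointAlgebraicNumericalRange F) p := by
  have hne_empty : ∀ G : Set (EuclideanSpace ℝ (Fin 3)), IsSegment G → G.Nonempty := by
    rintro G ⟨a, b, -, rfl⟩
    exact ⟨a, left_mem_segment ℝ a b⟩
  obtain ⟨l₁, c₁, hl₁, rfl⟩ := hG₁.1.exists_eq_level (hne_empty _ hs₁)
  obtain ⟨l₂, c₂, hl₂, rfl⟩ := hG₂.1.exists_eq_level (hne_empty _ hs₂)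
  have hr₁ := finrank_faceSpace_eq_two hF hl₁ hs₁ hG₁.2.1
  have hr₂ := finrank_faceSpace_eq_two hF hl₂ hs₂ hG₂.2.1
  set V₁ := faceSpace F l₁ c₁
  set V₂ := faceSpace F l₂ c₂
  have hV : V₁ ≠ V₂ := by
    intro h
    refine hne (Set.ext fun y => and_congr_right fun hy => ?_)
    obtain ⟨b, hb, rfl⟩ := mem_jointAlgebraicNumericalRange_iff.1 hy
    rw [apply_sum_vectorValue_eq_iff hF hl₁ hb, apply_sum_vectorValue_eq_iff hF hl₂ hb]
    exact forall_congr' fun k => by rw [show faceSpace F l₁ c₁ = faceSpace F l₂ c₂ from h]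
  have hsum := Submodule.finrank_sup_add_finrank_inf_eq V₁ V₂
  have hinf_lt : Module.finrank ℂ ↥(V₁ ⊓ V₂) < 2 := by
    rw [← hr₁]
    refine Submodule.finrank_lt_finrank_of_lt (lt_of_le_of_ne inf_le_left fun h => hV ?_)
    exact Submodule.eq_of_le_of_finrank_eq (inf_eq_left.1 h) (hr₁.trans hr₂.symm)
  have h3 : Module.finrank ℂ (EuclideanSpace ℂ (Fin 3)) = 3 := by simp
  have hsup_le : Module.finrank ℂ ↥(V₁ ⊔ V₂) ≤ 3 :=
    (Submodule.finrank_le _).trans_eq h3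
  have htop : V₁ ⊔ V₂ = ⊤ := Submodule.eq_top_of_finrank_eq (by rw [h3]; omega)
  obtain ⟨x, hx, hx0⟩ := (V₁ ⊓ V₂).ne_bot_iff.1 fun h => by
    rw [h, finrank_bot] at hsum
    omega
  obtain ⟨e, ⟨he₁, he₂⟩, hn⟩ : ∃ e ∈ V₁ ⊓ V₂, ‖e‖ = 1 :=
    ⟨((‖x‖⁻¹ : ℝ) : ℂ) • x, Submodule.smul_mem _ _ hx, norm_ofReal_inv_norm_smul hx0⟩
  have he0 : e ≠ 0 := fun h => by simp [h] at hn
  have hv₁ : l₁ (vectorValue F e) = c₁ := by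
    rw [(mem_faceSpace_iff hF hl₁).1 he₁, hn, one_pow, mul_one]
  have hv₂ : l₂ (vectorValue F e) = c₂ := by
    rw [(mem_faceSpace_iff hF hl₂).1 he₂, hn, one_pow, mul_one]
  have hinter : {y ∈ jointAlgebraicNumericalRange F | l₁ y = c₁} ∩
      {y ∈ jointAlgebraicNumericalRange F | l₂ y = c₂} = {vectorValue F e} := by
    refine Set.Subset.antisymm ?_ (Set.singleton_subset_iff.2
      ⟨⟨vectorValue_mem hn, hv₁⟩, ⟨vectorValue_mem hn, hv₂⟩⟩)
    rintro y ⟨⟨hy, hy₁⟩, -, hy₂⟩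
    obtain ⟨b, hb, rfl⟩ := mem_jointAlgebraicNumericalRange_iff.1 hy
    exact sum_vectorValue_eq_of_finrank_le_one (Nat.le_of_lt_succ hinf_lt) ⟨he₁, he₂⟩ hn hb
      fun k => ⟨(apply_sum_vectorValue_eq_iff hF hl₁ hb).1 hy₁ k,
        (apply_sum_vectorValue_eq_iff hF hl₂ hb).1 hy₂ k⟩
  refine ⟨vectorValue F e, hinter, ?_⟩
  -- A functional constant on a segment through the intersection point attains its maximum on
  -- all of it, so that both endpoints would lie in the intersection.
  have hnonconst : ∀ {l l' : StrongDual ℝ (EuclideanSpace ℝ (Fin 3))} {c c' : ℝ}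
      {a b : EuclideanSpace ℝ (Fin 3)}, a ≠ b →
      {y ∈ jointAlgebraicNumericalRange F | l y = c} = segment ℝ a b →
      l (vectorValue F e) = c → l' (vectorValue F e) = c' →
      {y ∈ jointAlgebraicNumericalRange F | l y = c} ∩
        {y ∈ jointAlgebraicNumericalRange F | l' y = c'} = {vectorValue F e} → l' a ≠ l' b := by
    intro l l' c c' a b hab hG hc hc' hint hl
    have hp : vectorValue F e ∈ segment ℝ a b := hG ▸ ⟨vectorValue_mem hn, hc⟩
    rw [segment_eq_image'] at hp
    obtain ⟨t, -, ht⟩ := hp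
    have hla : l' a = c' := by
      rw [← hc', ← ht]
      simp [hl]
    have ha := hG.symm ▸ left_mem_segment ℝ a b
    have hb := hG.symm ▸ right_mem_segment ℝ a b
    have ha' : a ∈ ({vectorValue F e} : Set _) := hint ▸ ⟨ha, ha.1, hla⟩
    have hb' : b ∈ ({vectorValue F e} : Set _) := hint ▸ ⟨hb, hb.1, hl ▸ hla⟩
    exact hab (ha'.trans hb'.symm)
  obtain ⟨a₁, b₁, hab₁, hseg₁⟩ := hs₁
  obtain ⟨a₂, b₂, hab₂, hseg₂⟩ := hs₂
  have hsplit : ∀ i, (F i).toEuclideanLin e = (vectorValue F e i : ℂ) • e := fun i =>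
    toEuclideanLin_apply_eq_smul hF hn he₁ he₂ htop
      (fun w hw hew => inner_apply_eq_zero_of_segment hF hl₁ hseg₁
        (hnonconst hab₁ hseg₁ hv₁ hv₂ hinter) he₁ he₂ he0 hw hew i)
      (fun w hw hew => inner_apply_eq_zero_of_segment hF hl₂ hseg₂
        (hnonconst hab₂ hseg₂ hv₂ hv₁ (by rw [Set.inter_comm, hinter])) he₂ he₁ he0 hw hew i)
  -- A unit vector at which `l₁ + l₂` reaches `c₁ + c₂` lies in `V₁ ⊓ V₂`, the line through `e`.
  refine isCornerPoint_vectorValue (l := l₁ + l₂) hF hn hsplit fun y hy hey => ?_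
  have h₁ := hl₁ y
  have h₂ := hl₂ y
  rw [hy, one_pow, mul_one] at h₁ h₂
  rw [add_apply, add_apply, hv₁, hv₂]
  refine lt_of_le_of_ne (add_le_add h₁ h₂) fun heq => ?_
  have hy₁ : y ∈ V₁ := (mem_faceSpace_iff hF hl₁).2 (by rw [hy]; linarith)
  have hy₂ : y ∈ V₂ := (mem_faceSpace_iff hF hl₂).2 (by rw [hy]; linarith)
  obtain ⟨z, rfl⟩ := Submodule.exists_smul_eq_of_finrank_le_one (Nat.le_of_lt_succ hinf_lt)
    ⟨he₁, he₂⟩ he0 ⟨hy₁, hy₂⟩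
  rw [inner_smul_right, inner_self_eq_norm_sq_to_K, hn] at hey
  have hz : z = 0 := by simpa using hey
  simp [hz] at hy
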